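/- For integers $n\ge 1$, $d\ge 2$, a noise level $\sigma>0$ and $p\in(0,1]$, let $\mathcal O(d)=\{U\in\mathbb R^{d\times d}: UU^{T}=U^{T}U=I_d\}$, and for $Z=(Z_1,\dots,Z_n)\in\mathcal O(d)^n$ let $\mathbb E_Z$ denote expectation under the following model. For all $1\le i<j\le n$, $A_{ij}\sim\mathrm{Bernoulli}(p)$ and $W_{ij}\in\mathbb R^{d\times d}$ is a random matrix with independent standard normal entries, all of these variables being independent. One observes the $A_{ij}$ for all $i<j$, and $Y_{ij}=Z_iZ_j^{T}+\sigma W_{ij}$ for those pairs $i<j$ with $A_{ij}=1$. An estimator $\widehat Z$ is a measurable, possibly randomized, function of these observations with values in $\mathcal O(d)^n$, and its loss is $$\ell(\widehat Z,Z)=\min_{B\in\mathcal O(d)}\frac1n\sum_{i=1}^n\|\widehat Z_i-Z_iB\|_{F}^2 .$$ Theorem. There is a constant $c>0$, and for every $C_1$ there is a constant $C>0$ depending only on $C_1$, such that, whenever $\frac{np}{\sigma^2}\ge c$ and $2\le d\le C_1$, $$\inf_{\widehat Z}\ \sup_{Z\in\mathcal O(d)^n}\mathbb E_Z\,\ell(\widehat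 Z,Z)\ \ge\ \left(1-C\left(\frac1n+\frac{\sigma^2}{np}\right)\right)\frac{\sigma^2d(d-1)}{2np},$$ where the infimum is over all estimators $\widehat Z$. -/

import Mathlib

open MeasureTheory ProbabilityTheory
open scoped Matrix

noncomputable section

/-- Real matrices carry the product sigma-algebra of their entries. -/
instance Matrix.instMeasurableSpaceReal {m k : Type*} : MeasurableSpace (Matrix m k ℝ) :=
  inferInstanceAs (MeasurableSpace (m → k → ℝ))

namespace OrthSync

/-- The squared Frobenius norm of a real matrix. -/
def frobSq {d : ℕ} (M : Matrix (Fin d) (Fin d) ℝ) : ℝ := ∑ a, ∑ b, M a b ^ 2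

/-- The parameter space `O(d)^n`. -/
abbrev Param (n d : ℕ) : Type := Fin n → Matrix.orthogonalGroup (Fin d) ℝ

/-- The loss `min_{B ∈ O(d)} (1/n) ∑ i, ‖Zhat i - Z i * B‖_F ^ 2`. The minimum is attained, the
objective being continuous on a compact set, so it is the infimum. -/
def loss {n d : ℕ} (Zhat Z : Param n d) : ℝ :=
  ⨅ B : Matrix.orthogonalGroup (Fin d) ℝ,
    (1 / (n : ℝ)) * ∑ i, frobSq ((Zhat i : Matrix (Fin d) (Fin d) ℝ) -
      (Z i : Matrix (Fin d) (Fin d) ℝ) * (B : Matrix (Fin d) (Fin d) ℝ))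

/-- The pairs `(i, j)` with `i < j`. -/
abbrev Pair (n : ℕ) : Type := {e : Fin n × Fin n // e.1 < e.2}

/-- The sample space: for every pair `i < j` a bit (is the pair observed?) and a matrix. -/
abbrev Sample (n d : ℕ) : Type := Pair n → Bool × Matrix (Fin d) (Fin d) ℝ

/-- The law of a `d × d` matrix with independent standard normal entries. -/
def gaussianMatrix (d : ℕ) : Measure (Matrix (Fin d) (Fin d) ℝ) :=
  Measure.pi (fun _ : Fin d => Measure.pi (fun _ : Fin d => gaussianReal 0 1))

/-- The joint law of the `(A i j, W i j)`, `i < j`: all are independent, with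
`A i j ∼ Bernoulli(p)` and `W i j` a matrix with independent standard normal entries. -/
def noiseLaw (n d : ℕ) (p : unitInterval) : Measure (Sample n d) :=
  Measure.pi (fun _ : Pair n => (bernoulliMeasure true false p).prod (gaussianMatrix d))

/-- The data produced from the parameter `Z` and the randomness `ω = (A, W)`: the bits `A i j`
together with `Y i j = Z i * (Z j)ᵀ + σ • W i j` for the pairs with `A i j` true. For the other
pairs the matrix is replaced by `0`, so that it carries no information. -/
def observe {n d : ℕ} (σ : ℝ) (Z : Param n d) (ω : Sample n d) : Sample n d := fun e =>
  ((ω e).1,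
    if (ω e).1 = true then
      (Z e.1.1 : Matrix (Fin d) (Fin d) ℝ) * (Z e.1.2 : Matrix (Fin d) (Fin d) ℝ)ᵀ + σ • (ω e).2
    else 0)

theorem measurable_observe {n d : ℕ} (σ : ℝ) :
    Measurable (fun x : Param n d × Sample n d => observe σ x.1 x.2) := by
  have hent : ∀ (i : Fin n) (a b : Fin d),
      Measurable fun x : Param n d × Sample n d => (x.1 i : Matrix (Fin d) (Fin d) ℝ) a b := by
    intro i a b
    exact (measurable_pi_apply b).comp ((measurable_pi_apply a).comp
      (measurable_subtype_coe.comp ((measurable_pi_apply i).comp measurable_fst)))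
  refine measurable_pi_lambda _ fun e => ?_
  have he : Measurable fun x : Param n d × Sample n d => x.2 e :=
    (measurable_pi_apply e).comp measurable_snd
  refine (measurable_fst.comp he).prodMk ?_
  refine Measurable.ite ((measurable_fst.comp he) (measurableSet_singleton true)) ?_
    measurable_const
  refine measurable_pi_lambda _ fun a => measurable_pi_lambda _ fun b => ?_
  have hW : Measurable fun x : Param n d × Sample n d => (x.2 e).2 a b :=
    (measurable_pi_apply b).comp ((measurable_pi_apply a).comp (measurable_snd.comp he))
  simp only [Matrix.add_apply, Matrix.mul_apply, Matrix.transpose_apply, Matrix.smul_apply,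
    smul_eq_mul]
  exact (Finset.measurable_sum _ fun c _ => (hent _ a c).mul (hent _ b c)).add (hW.const_mul σ)

instance {d : ℕ} : IsProbabilityMeasure (gaussianMatrix d) :=
  inferInstanceAs (IsProbabilityMeasure
    (Measure.pi (fun _ : Fin d => Measure.pi (fun _ : Fin d => gaussianReal 0 1))))

instance {n d : ℕ} {p : unitInterval} : IsProbabilityMeasure (noiseLaw n d p) := by
  unfold noiseLaw; infer_instance

/-- The statistical model: `Z` is sent to the law `P_Z` of the data. -/
def model (n d : ℕ) (σ : ℝ) (p : unitInterval) : Kernel (Param n d) (Sample n d) where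
  toFun Z := (noiseLaw n d p).map (observe σ Z)
  measurable' := by
    refine Measure.measurable_of_measurable_coe _ fun s hs => ?_
    have h (Z : Param n d) : (noiseLaw n d p).map (observe σ Z) s =
        noiseLaw n d p (Prod.mk Z ⁻¹' ((fun x : Param n d × Sample n d =>
          observe σ x.1 x.2) ⁻¹' s)) :=
      Measure.map_apply ((measurable_observe σ).comp measurable_prodMk_left) hs
    simp only [h]
    exact measurable_measure_prodMk_left (measurable_observe σ hs)

/-- The minimax risk of `O(d)` synchronization: the infimum over all estimators (Markov kernels
from the data to `O(d)^n`, in particular all measurable maps `Zhat` of the data) of the supremum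
over `Z ∈ O(d)^n` of `E_Z (loss Zhat Z)`. The expectations of the nonnegative loss, and the
infimum and supremum, are taken in `[0, ∞]`. -/
def risk (n d : ℕ) (σ : ℝ) (p : unitInterval) : ENNReal :=
  minimaxRisk (fun Z Zhat : Param n d => ENNReal.ofReal (loss Zhat Z)) (model n d σ p)

end OrthSync

end

open MeasureTheory ProbabilityTheory
open scoped Matrix

noncomputable section
namespace OrthSync

/-! The minimax risk is at least the Bayes risk under an invariant prior, and that is bounded by a
Cramér-Rao argument for each pair of indices and each coordinate plane. By `sum_relErr_le_loss` the
minimum over the global rotation `B` costs nothing: the loss dominates an average of errors of the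
relative orientations `Zᵢ Zⱼᵀ`, which `B` does not affect.

Fix `i ≠ j` and a plane `(a, b)`. Rotate `Zᵢ` by `t / 2` and `Zⱼ` by `-t / 2` in that plane. To
second order the chi-square divergence between the two laws of the data is `I t²` with `I = n p /
σ²`; moving one index alone would give nearly twice as much. The test function is the skew component
of the relative error. Its mean changes at rate equal to the diagonal part of the error on the
plane. The chi-square inequality (`chiSq_bound`), averaged over a prior that the rotation preserves
and so without any prior information term, gives `integral_diagErr_le` as `t → 0`.

For orthogonal matrices the diagonal is an affine function of the squared error, and the skew
components are controlled by that error. Summing over the planes therefore closes into a linear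
inequality for the pair risk, `R ≥ d (d - 1) / (I + d - 1)` (`pair_bayes_bound`); the extra `d - 1`
is the effect of curvature. Summing over pairs costs a factor `1 - 1 / n`. -/

/-! ### Changes of measure with square-integrable density -/

/-- The image of `μ` under `T` has the square-integrable density `f` with respect to `μ`,
whose second moment is `v`. -/
structure IsTilt {α : Type*} [MeasurableSpace α] (μ : Measure α) (T : α → α) (f : α → ℝ)
    (v : ℝ) : Prop where
  measurable_map : Measurable T
  measurable_density : Measurable f
  nonneg : ∀ x, 0 ≤ f x
  integrable_sq : Integrable (fun x => f x ^ 2) μ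
  integral_sq : ∫ x, f x ^ 2 ∂μ = v
  map_eq : μ.map T = μ.withDensity (fun x => ENNReal.ofReal (f x))

namespace IsTilt

variable {α : Type*} [MeasurableSpace α] {μ : Measure α} {T : α → α} {f : α → ℝ} {v : ℝ}

theorem integrable [IsProbabilityMeasure μ] (h : IsTilt μ T f v) : Integrable f μ :=
  ((memLp_two_iff_integrable_sq h.measurable_density.aestronglyMeasurable).2
    h.integrable_sq).integrable (by norm_num)

theorem integral_comp (h : IsTilt μ T f v) {g : α → ℝ} (hg : Measurable g) :
    ∫ x, g (T x) ∂μ = ∫ x, f x * g x ∂μ := by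
  rw [← integral_map (φ := T) (f := g) h.measurable_map.aemeasurable hg.aestronglyMeasurable,
    h.map_eq,
    integral_withDensity_eq_integral_toReal_smul
      (f := fun x => ENNReal.ofReal (f x)) (ENNReal.measurable_ofReal.comp h.measurable_density)
      (by simp)]
  refine integral_congr_ae (Filter.Eventually.of_forall fun x => ?_)
  simp [ENNReal.toReal_ofReal (h.nonneg x)]

theorem integral_eq_one [IsProbabilityMeasure μ] (h : IsTilt μ T f v) : ∫ x, f x ∂μ = 1 := by
  have := h.integral_comp (g := fun _ => 1) measurable_const
  simpa using this.symm

/-- A variational form of the chi-square bound for the difference of two expectations. -/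
theorem integral_comp_sub_le [IsProbabilityMeasure μ] (h : IsTilt μ T f v) {g g₂ : α → ℝ}
    {l B : ℝ} (hg : Measurable g) (hB : ∀ x, |g x| ≤ B) (hg₂ : Integrable g₂ μ)
    (hle : ∀ x s, s * g x ≤ l / 2 * g₂ x + s ^ 2 / (2 * l)) :
    ∫ x, g (T x) ∂μ - ∫ x, g x ∂μ ≤ l / 2 * ∫ x, g₂ x ∂μ + (v - 1) / (2 * l) := by
  have hgi : Integrable g μ :=
    Integrable.of_bound hg.aestronglyMeasurable B (Filter.Eventually.of_forall hB)
  have hfg : Integrable (fun x => f x * g x) μ :=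
    h.integrable.mul_bdd (c := B) hg.aestronglyMeasurable (Filter.Eventually.of_forall hB)
  have hsq : Integrable (fun x => (f x - 1) ^ 2) μ := by
    have : (fun x => (f x - 1) ^ 2) = fun x => f x ^ 2 - 2 * f x + 1 := by
      funext x; ring
    rw [this]
    exact (h.integrable_sq.sub (h.integrable.const_mul 2)).add (integrable_const 1)
  have hsqv : ∫ x, (f x - 1) ^ 2 ∂μ = v - 1 := by
    have : (fun x => (f x - 1) ^ 2) = fun x => (f x ^ 2 - 2 * f x) + 1 := by
      funext x; ring
    have hi : Integrable (fun x => f x ^ 2 - 2 * f x) μ :=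
      h.integrable_sq.sub (h.integrable.const_mul 2)
    rw [this, integral_add hi (integrable_const 1),
      integral_sub h.integrable_sq (h.integrable.const_mul 2), integral_const_mul,
      h.integral_eq_one, h.integral_sq]
    simp; ring
  rw [h.integral_comp hg, ← integral_sub hfg hgi, ← integral_const_mul, ← hsqv,
    ← integral_div, ← integral_add (hg₂.const_mul _) (hsq.div_const _)]
  refine integral_mono (hfg.sub hgi) ((hg₂.const_mul _).add (hsq.div_const _)) fun x => ?_
  -- With `s` the centred density, the mean of `s ^ 2` is the chi-square divergence `v - 1`, and the
  -- mean of `s * g` is the difference of expectations.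
  have := hle x (f x - 1)
  simp only
  linarith

theorem pi {ι : Type*} [Fintype ι] {E : ι → Type*} [∀ i, MeasurableSpace (E i)]
    {ν : ∀ i, Measure (E i)} [∀ i, IsProbabilityMeasure (ν i)] {S : ∀ i, E i → E i}
    {r : ∀ i, E i → ℝ} {w : ι → ℝ} (h : ∀ i, IsTilt (ν i) (S i) (r i) (w i)) :
    IsTilt (Measure.pi ν) (fun x i => S i (x i)) (fun x => ∏ i, r i (x i)) (∏ i, w i) where
  measurable_map := measurable_pi_lambda _ fun i =>
    (h i).measurable_map.comp (measurable_pi_apply i)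
  measurable_density := Finset.measurable_prod _ fun i _ =>
    (h i).measurable_density.comp (measurable_pi_apply i)
  nonneg x := Finset.prod_nonneg fun i _ => (h i).nonneg _
  integrable_sq := by
    simp_rw [← Finset.prod_pow]
    exact Integrable.fintype_prod_dep (f := fun i x => r i x ^ 2) fun i => (h i).integrable_sq
  integral_sq := by
    simp_rw [← Finset.prod_pow]
    rw [integral_fintype_prod_eq_prod (fun i x => r i x ^ 2)]
    exact Finset.prod_congr rfl fun i _ => (h i).integral_sq
  map_eq := by
    have (i : ι) : IsProbabilityMeasure ((ν i).map (S i)) :=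
      Measure.isProbabilityMeasure_map (h i).measurable_map.aemeasurable
    rw [Measure.pi_map_pi fun i => (h i).measurable_map.aemeasurable]
    refine Measure.pi_eq fun s hs => ?_
    have hint (i : ι) : Integrable (r i) ((ν i).restrict (s i)) := (h i).integrable.restrict
    rw [withDensity_apply _ (MeasurableSet.univ_pi hs), Measure.restrict_pi_pi,
      ← ofReal_integral_eq_lintegral_ofReal
        (Integrable.fintype_prod_dep (f := fun i x => r i x) hint)
        (Filter.Eventually.of_forall fun x => Finset.prod_nonneg fun i _ => (h i).nonneg _),
      integral_fintype_prod_eq_prod (fun i x => r i x),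
      ENNReal.ofReal_prod_of_nonneg fun i _ => integral_nonneg (h i).nonneg]
    refine Finset.prod_congr rfl fun i _ => ?_
    rw [(h i).map_eq, withDensity_apply _ (hs i),
      ofReal_integral_eq_lintegral_ofReal (hint i) (Filter.Eventually.of_forall (h i).nonneg)]

theorem lintegral_bernoulli_prod [SFinite μ] (p : unitInterval) {F : Bool × α → ENNReal}
    (hF : Measurable F) :
    ∫⁻ x, F x ∂((bernoulliMeasure true false p).prod μ) =
      unitInterval.toNNReal p * ∫⁻ x, F (true, x) ∂μ +
        unitInterval.toNNReal (unitInterval.symm p) * ∫⁻ x, F (false, x) ∂μ := by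
  rw [lintegral_prod _ hF.aemeasurable, bernoulliMeasure_def, lintegral_add_measure,
    lintegral_smul_measure, lintegral_smul_measure, lintegral_dirac, lintegral_dirac]
  rfl

/-- An unobserved pair is left alone, so its density is `1`; the second moment is the mixture of `v`
and `1`. -/
theorem bernoulli_prod [IsProbabilityMeasure μ] (p : unitInterval) (h : IsTilt μ T f v) :
    IsTilt ((bernoulliMeasure true false p).prod μ)
      (fun x => (x.1, if x.1 = true then T x.2 else x.2))
      (fun x => if x.1 = true then f x.2 else 1) (p * v + (1 - p)) := by
  have hset : MeasurableSet {x : Bool × α | x.1 = true} :=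
    measurable_fst (measurableSet_singleton true)
  have hm : Measurable fun x : Bool × α => (x.1, if x.1 = true then T x.2 else x.2) :=
    measurable_fst.prodMk (Measurable.ite hset (h.measurable_map.comp measurable_snd)
      measurable_snd)
  have hd : Measurable fun x : Bool × α => if x.1 = true then f x.2 else 1 :=
    Measurable.ite hset (h.measurable_density.comp measurable_snd) measurable_const
  have hlint : ∫⁻ x, ENNReal.ofReal ((if x.1 = true then f x.2 else 1) ^ 2)
      ∂((bernoulliMeasure true false p).prod μ) = ENNReal.ofReal (p * v + (1 - p)) := by
    rw [lintegral_bernoulli_prod p (by fun_prop)]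
    have hv : 0 ≤ v := by rw [← h.integral_sq]; positivity
    have h1 : ∫⁻ x, ENNReal.ofReal (f x ^ 2) ∂μ = ENNReal.ofReal v := by
      rw [← ofReal_integral_eq_lintegral_ofReal h.integrable_sq
        (Filter.Eventually.of_forall fun x => sq_nonneg _), h.integral_sq]
    have hp : (unitInterval.toNNReal p : ENNReal) = ENNReal.ofReal p := by
      rw [ENNReal.ofReal, Real.toNNReal_of_nonneg p.2.1]; rfl
    have hq : (unitInterval.toNNReal (unitInterval.symm p) : ENNReal) = ENNReal.ofReal (1 - p) := by
      rw [ENNReal.ofReal, Real.toNNReal_of_nonneg (by linarith [p.2.2])]; rfl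
    simp [h1, hp, hq]
    rw [ENNReal.ofReal_add (mul_nonneg p.2.1 hv) (by linarith [p.2.2]),
      ENNReal.ofReal_mul p.2.1]
  have hsqm : Measurable fun x : Bool × α => (if x.1 = true then f x.2 else 1) ^ 2 := hd.pow_const 2
  refine ⟨hm, hd, fun x => ?_, ?_, ?_, ?_⟩
  · split_ifs
    exacts [h.nonneg _, zero_le_one]
  · refine ⟨hsqm.aestronglyMeasurable, ?_⟩
    rw [hasFiniteIntegral_iff_ofReal (Filter.Eventually.of_forall fun x => sq_nonneg _), hlint]
    exact ENNReal.ofReal_lt_top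
  · rw [integral_eq_lintegral_of_nonneg_ae (Filter.Eventually.of_forall fun x => sq_nonneg _)
      hsqm.aestronglyMeasurable, hlint, ENNReal.toReal_ofReal]
    have hv : 0 ≤ v := by rw [← h.integral_sq]; positivity
    exact add_nonneg (mul_nonneg p.2.1 hv) (by linarith [p.2.2])
  · refine Measure.ext_of_lintegral _ fun F hF => ?_
    have hT : ∫⁻ x, F (true, T x) ∂μ = ∫⁻ x, ENNReal.ofReal (f x) * F (true, x) ∂μ := by
      have hF1 : Measurable fun x => F (true, x) := hF.comp measurable_prodMk_left
      rw [← lintegral_map (f := fun x => F (true, x)) (g := T) hF1 h.measurable_map, h.map_eq,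
        lintegral_withDensity_eq_lintegral_mul (f := fun x => ENNReal.ofReal (f x)) _
          (ENNReal.measurable_ofReal.comp h.measurable_density) hF1]
      rfl
    have hd' : Measurable fun x : Bool × α => ENNReal.ofReal (if x.1 = true then f x.2 else 1) :=
      ENNReal.measurable_ofReal.comp hd
    rw [lintegral_map hF hm, lintegral_withDensity_eq_lintegral_mul _ hd' hF,
      lintegral_bernoulli_prod p (F := fun x => F (x.1, if x.1 = true then T x.2 else x.2))
        (hF.comp hm), lintegral_bernoulli_prod p (hd'.mul hF)]
    simp [hT]

theorem gaussianReal (a : ℝ) :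
    IsTilt (gaussianReal 0 1) (fun x => x + a) (fun x => Real.exp (a * x - a ^ 2 / 2))
      (Real.exp (a ^ 2)) := by
  have hmap (b : ℝ) : (ProbabilityTheory.gaussianReal 0 1).map (fun x => x + b) =
      (ProbabilityTheory.gaussianReal 0 1).withDensity
        fun x => ENNReal.ofReal (Real.exp (b * x - b ^ 2 / 2)) := by
    rw [gaussianReal_map_add_const, gaussianReal_of_var_ne_zero _ one_ne_zero,
      gaussianReal_of_var_ne_zero _ one_ne_zero,
      ← withDensity_mul _ (measurable_gaussianPDF _ _) (by fun_prop)]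
    congr 1
    funext x
    simp only [gaussianPDF, gaussianPDFReal, Pi.mul_apply]
    rw [← ENNReal.ofReal_mul (by positivity), mul_assoc _ _ (Real.exp (b * x - b ^ 2 / 2)),
      ← Real.exp_add]
    congr 3
    simp
    ring
  have hint (b : ℝ) : Integrable (fun x => Real.exp (b * x - b ^ 2 / 2))
      (ProbabilityTheory.gaussianReal 0 1) := by
    simp_rw [Real.exp_sub]
    exact (integrable_exp_mul_gaussianReal b).div_const _
  -- The squared density is `exp (a ^ 2)` times the density of the shift by `2 * a`, which has mass
  -- one.
  have hsq : (fun x => Real.exp (a * x - a ^ 2 / 2) ^ 2) =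
      fun x => Real.exp (a ^ 2) * Real.exp ((2 * a) * x - (2 * a) ^ 2 / 2) := by
    funext x
    rw [← Real.exp_nat_mul, ← Real.exp_add]
    congr 1
    push_cast; ring
  refine ⟨by fun_prop, by fun_prop, fun x => (Real.exp_pos _).le, ?_, ?_, hmap a⟩
  · rw [hsq]; exact (hint _).const_mul _
  · have h1 : ∫⁻ x, ENNReal.ofReal (Real.exp ((2 * a) * x - (2 * a) ^ 2 / 2))
        ∂(ProbabilityTheory.gaussianReal 0 1) = 1 := by
      rw [← setLIntegral_univ, ← withDensity_apply _ MeasurableSet.univ, ← hmap,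
        Measure.map_apply (by fun_prop) MeasurableSet.univ]
      simp
    rw [hsq, integral_const_mul, integral_eq_lintegral_of_nonneg_ae
      (Filter.Eventually.of_forall fun x => (Real.exp_pos _).le) (by fun_prop), h1]
    simp

end IsTilt

theorem isTilt_gaussianMatrix {d : ℕ} (V : Matrix (Fin d) (Fin d) ℝ) :
    ∃ f, IsTilt (gaussianMatrix d) (fun W => W + V) f (Real.exp (frobSq V)) := by
  have h := IsTilt.pi fun a : Fin d => IsTilt.pi fun b : Fin d => IsTilt.gaussianReal (V a b)
  simp_rw [← Real.exp_sum] at h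
  exact ⟨_, h⟩

/-- Adding `V e` to the observed noise matrices. -/
def shift {n d : ℕ} (V : Pair n → Matrix (Fin d) (Fin d) ℝ) (ω : Sample n d) : Sample n d :=
  fun e => ((ω e).1, if (ω e).1 = true then (ω e).2 + V e else (ω e).2)

theorem isTilt_noiseLaw {n d : ℕ} (p : unitInterval) (V : Pair n → Matrix (Fin d) (Fin d) ℝ) :
    ∃ f, IsTilt (noiseLaw n d p) (shift V) f
      (∏ e, (p * Real.exp (frobSq (V e)) + (1 - p))) := by
  choose f hf using fun e => isTilt_gaussianMatrix (V e)
  exact ⟨_, IsTilt.pi fun e => (hf e).bernoulli_prod p⟩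

/-- A change of parameter is absorbed into a translation of the noise, so laws at different
parameters are compared through one fixed `Z`. -/
theorem observe_shift {n d : ℕ} {σ : ℝ} (hσ : σ ≠ 0) (Z Z' : Param n d) (ω : Sample n d) :
    observe σ Z (shift (fun e => σ⁻¹ • ((Z' e.1.1 : Matrix (Fin d) (Fin d) ℝ) *
        (Z' e.1.2 : Matrix (Fin d) (Fin d) ℝ)ᵀ - (Z e.1.1 : Matrix (Fin d) (Fin d) ℝ) *
        (Z e.1.2 : Matrix (Fin d) (Fin d) ℝ)ᵀ)) ω) = observe σ Z' ω := by
  funext e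
  simp only [observe, shift]
  refine Prod.ext rfl ?_
  dsimp only
  split_ifs
  · rw [smul_add, smul_smul, mul_inv_cancel₀ hσ, one_smul]
    abel
  · rfl

/-! ### Frobenius norm and orthogonal matrices -/

section Frobenius

variable {d : ℕ}

theorem frobSq_eq_trace (M : Matrix (Fin d) (Fin d) ℝ) : frobSq M = (M * Mᵀ).trace := by
  simp [frobSq, Matrix.trace, Matrix.mul_apply, sq]

theorem frobSq_nonneg (M : Matrix (Fin d) (Fin d) ℝ) : 0 ≤ frobSq M :=
  Finset.sum_nonneg fun _ _ => Finset.sum_nonneg fun _ _ => sq_nonneg _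

theorem frobSq_smul (c : ℝ) (M : Matrix (Fin d) (Fin d) ℝ) : frobSq (c • M) = c ^ 2 * frobSq M := by
  simp [frobSq, Finset.mul_sum, mul_pow]

theorem frobSq_sub (M N : Matrix (Fin d) (Fin d) ℝ) :
    frobSq (M - N) = frobSq M + frobSq N - 2 * (M * Nᵀ).trace := by
  have h : (N * Mᵀ).trace = (M * Nᵀ).trace := by
    rw [← Matrix.trace_transpose, Matrix.transpose_mul, Matrix.transpose_transpose]
  simp only [frobSq_eq_trace, Matrix.transpose_sub, Matrix.sub_mul, Matrix.mul_sub,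
    Matrix.trace_sub, h]
  ring

theorem coe_mul_transpose (U : Matrix.orthogonalGroup (Fin d) ℝ) :
    (U : Matrix (Fin d) (Fin d) ℝ) * (U : Matrix (Fin d) (Fin d) ℝ)ᵀ = 1 :=
  (Matrix.mem_orthogonalGroup_iff (Fin d) ℝ).1 U.2

theorem coe_inv (U : Matrix.orthogonalGroup (Fin d) ℝ) :
    ((U⁻¹ : Matrix.orthogonalGroup (Fin d) ℝ) : Matrix (Fin d) (Fin d) ℝ) =
      (U : Matrix (Fin d) (Fin d) ℝ)ᵀ := rfl

theorem transpose_mul_coe (U : Matrix.orthogonalGroup (Fin d) ℝ) :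
    (U : Matrix (Fin d) (Fin d) ℝ)ᵀ * (U : Matrix (Fin d) (Fin d) ℝ) = 1 :=
  (Matrix.mem_orthogonalGroup_iff' (Fin d) ℝ).1 U.2

theorem frobSq_coe (U : Matrix.orthogonalGroup (Fin d) ℝ) :
    frobSq (U : Matrix (Fin d) (Fin d) ℝ) = d := by
  rw [frobSq_eq_trace, coe_mul_transpose]
  simp

theorem frobSq_coe_mul (U : Matrix.orthogonalGroup (Fin d) ℝ) (M : Matrix (Fin d) (Fin d) ℝ) :
    frobSq ((U : Matrix (Fin d) (Fin d) ℝ) * M) = frobSq M := by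
  rw [frobSq_eq_trace, frobSq_eq_trace, Matrix.transpose_mul, Matrix.trace_mul_comm,
    Matrix.mul_assoc, ← Matrix.mul_assoc _ (U : Matrix (Fin d) (Fin d) ℝ), transpose_mul_coe,
    Matrix.one_mul, Matrix.trace_mul_comm]

theorem frobSq_mul_coe (M : Matrix (Fin d) (Fin d) ℝ) (U : Matrix.orthogonalGroup (Fin d) ℝ) :
    frobSq (M * (U : Matrix (Fin d) (Fin d) ℝ)) = frobSq M := by
  rw [frobSq_eq_trace, frobSq_eq_trace, Matrix.transpose_mul, Matrix.mul_assoc,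
    ← Matrix.mul_assoc (U : Matrix (Fin d) (Fin d) ℝ), coe_mul_transpose, Matrix.one_mul]

theorem frobSq_coe_sub_coe (U V : Matrix.orthogonalGroup (Fin d) ℝ) :
    frobSq ((U : Matrix (Fin d) (Fin d) ℝ) - (V : Matrix (Fin d) (Fin d) ℝ)) =
      2 * d - 2 * ((U : Matrix (Fin d) (Fin d) ℝ) * (V : Matrix (Fin d) (Fin d) ℝ)ᵀ).trace := by
  rw [frobSq_sub, frobSq_coe, frobSq_coe]; ring

theorem frobSq_coe_sub_one (U : Matrix.orthogonalGroup (Fin d) ℝ) :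
    frobSq ((U : Matrix (Fin d) (Fin d) ℝ) - 1) =
      2 * d - 2 * (U : Matrix (Fin d) (Fin d) ℝ).trace := by
  simpa using frobSq_coe_sub_coe U 1

theorem abs_coe_apply_le (U : Matrix.orthogonalGroup (Fin d) ℝ) (a b : Fin d) :
    |(U : Matrix (Fin d) (Fin d) ℝ) a b| ≤ 1 := by
  rw [← Real.norm_eq_abs]
  exact entry_norm_bound_of_unitary U.2 a b

/-- Summing the squares of the skew-symmetric components of `M - 1`. -/
theorem sum_sq_skew_le (M : Matrix (Fin d) (Fin d) ℝ) :
    ∑ a, ∑ b, (M a b - M b a) ^ 2 ≤ 4 * frobSq (M - 1) := by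
  -- Equality holds when `M - 1` is skew-symmetric, which is the first-order form of an orthogonal
  -- matrix near `1`; the leading constant is thus preserved.
  have h : ∀ a b, (M a b - M b a) ^ 2 ≤ 2 * (M - 1) a b ^ 2 + 2 * (M - 1) b a ^ 2 := by
    intro a b
    simp only [Matrix.sub_apply, Matrix.one_apply, eq_comm (a := b) (b := a)]
    nlinarith [sq_nonneg ((M a b - if a = b then 1 else 0) + (M b a - if a = b then 1 else 0))]
  calc ∑ a, ∑ b, (M a b - M b a) ^ 2
      ≤ ∑ a, ∑ b, (2 * (M - 1) a b ^ 2 + 2 * (M - 1) b a ^ 2) :=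
        Finset.sum_le_sum fun a _ => Finset.sum_le_sum fun b _ => h a b
    _ = 4 * frobSq (M - 1) := by
        simp only [Finset.sum_add_distrib, ← Finset.mul_sum]
        rw [Finset.sum_comm (f := fun a b => (M - 1) b a ^ 2), frobSq]
        ring

end Frobenius

/-! ### From the loss to relative errors -/

section Loss

variable {n d : ℕ}

/-- The relative error `(Zᵢ)ᵀ Ẑᵢ (Ẑⱼ)ᵀ Zⱼ`. -/
def relErr (i j : Fin n) (Z Zhat : Param n d) : Matrix.orthogonalGroup (Fin d) ℝ :=
  (Z i)⁻¹ * Zhat i * ((Z j)⁻¹ * Zhat j)⁻¹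

theorem relErr_mul_inv (i j : Fin n) (Z Zhat h : Param n d) :
    relErr i j (Z * h⁻¹) Zhat = h i * relErr i j Z Zhat * (h j)⁻¹ := by
  simp only [relErr, Pi.mul_apply, Pi.inv_apply]
  group

/-- Put `Uᵢ = Zᵢᵀ Ẑᵢ` and let `m` be their mean. The left side is `d - ‖m‖²` and the objective at
`B` is `2 d - 2 tr (m Bᵀ)`; the difference is `‖m - B‖² ≥ 0`. -/
theorem sum_relErr_le_loss (Z Zhat : Param n d) :
    1 / (2 * (n : ℝ) ^ 2) * ∑ i, ∑ j,
      frobSq ((relErr i j Z Zhat : Matrix (Fin d) (Fin d) ℝ) - 1) ≤ loss Zhat Z := by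
  refine le_ciInf fun B => ?_
  rcases Nat.eq_zero_or_pos n with rfl | hn
  · simp
  have hn' : (0 : ℝ) < n := Nat.cast_pos.2 hn
  set U : Fin n → Matrix.orthogonalGroup (Fin d) ℝ := fun i => (Z i)⁻¹ * Zhat i with hU
  set S : Matrix (Fin d) (Fin d) ℝ := ∑ i, (U i : Matrix (Fin d) (Fin d) ℝ) with hS
  have h1 : ∑ i, ∑ j, frobSq ((relErr i j Z Zhat : Matrix (Fin d) (Fin d) ℝ) - 1) =
      2 * n ^ 2 * d - 2 * frobSq S := by
    have : ∀ i j, frobSq ((relErr i j Z Zhat : Matrix (Fin d) (Fin d) ℝ) - 1) =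
        2 * d - 2 * ((U i : Matrix (Fin d) (Fin d) ℝ) * (U j : Matrix (Fin d) (Fin d) ℝ)ᵀ).trace :=
      fun i j => frobSq_coe_sub_one _
    simp only [this, Finset.sum_sub_distrib, ← Finset.mul_sum, ← Matrix.trace_sum,
      ← Matrix.transpose_sum, ← Finset.sum_mul, ← hS, frobSq_eq_trace]
    simp
    ring
  have h2 : ∑ i, frobSq ((Zhat i : Matrix (Fin d) (Fin d) ℝ) -
      (Z i : Matrix (Fin d) (Fin d) ℝ) * (B : Matrix (Fin d) (Fin d) ℝ)) =
      2 * n * d - 2 * (S * (B : Matrix (Fin d) (Fin d) ℝ)ᵀ).trace := by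
    have (i : Fin n) : frobSq ((Zhat i : Matrix (Fin d) (Fin d) ℝ) -
        (Z i : Matrix (Fin d) (Fin d) ℝ) * (B : Matrix (Fin d) (Fin d) ℝ)) =
        2 * d - 2 * ((U i : Matrix (Fin d) (Fin d) ℝ) *
          (B : Matrix (Fin d) (Fin d) ℝ)ᵀ).trace := by
      rw [← frobSq_coe_sub_coe, ← frobSq_coe_mul (Z i) ((U i : Matrix (Fin d) (Fin d) ℝ) - B),
        Matrix.mul_sub]
      have : (Zhat i : Matrix (Fin d) (Fin d) ℝ) =
          (Z i : Matrix (Fin d) (Fin d) ℝ) * (U i : Matrix (Fin d) (Fin d) ℝ) := by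
        have : Zhat i = Z i * U i := by simp [hU]
        rw [this]; rfl
      rw [this]
    simp only [this, Finset.sum_sub_distrib, ← Finset.mul_sum, ← Matrix.trace_sum,
      ← Finset.sum_mul, ← hS]
    simp
    ring
  have h3 := frobSq_nonneg ((n : ℝ)⁻¹ • S - (B : Matrix (Fin d) (Fin d) ℝ))
  rw [frobSq_sub, frobSq_smul, frobSq_coe, Matrix.smul_mul, Matrix.trace_smul, smul_eq_mul] at h3
  rw [h1, h2]
  have e1 : 1 / (2 * (n : ℝ) ^ 2) * (2 * n ^ 2 * d - 2 * frobSq S) =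
      d - (n : ℝ)⁻¹ ^ 2 * frobSq S := by field_simp
  have e2 : 1 / (n : ℝ) * (2 * n * d - 2 * (S * (B : Matrix (Fin d) (Fin d) ℝ)ᵀ).trace) =
      2 * d - 2 * ((n : ℝ)⁻¹ * (S * (B : Matrix (Fin d) (Fin d) ℝ)ᵀ).trace) := by field_simp
  rw [e1, e2]
  linarith

end Loss

/-! ### Rotations of a coordinate plane -/

section Rotation

variable {d : ℕ}

/-- The infinitesimal rotation of the coordinate plane `(a, b)`. -/
def skew (a b : Fin d) : Matrix (Fin d) (Fin d) ℝ := Matrix.single a b 1 - Matrix.single b a 1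

/-- The projection to the coordinate plane `(a, b)`. -/
def planeProj (a b : Fin d) : Matrix (Fin d) (Fin d) ℝ := Matrix.single a a 1 + Matrix.single b b 1

theorem skew_mul_skew {a b : Fin d} (h : a ≠ b) : skew a b * skew a b = -planeProj a b := by
  simp [skew, planeProj, Matrix.mul_sub, Matrix.sub_mul, h, h.symm]
  abel

theorem skew_mul_planeProj {a b : Fin d} (h : a ≠ b) : skew a b * planeProj a b = skew a b := by
  simp [skew, planeProj, Matrix.mul_add, Matrix.sub_mul, h, h.symm]
  abel

theorem planeProj_mul_skew {a b : Fin d} (h : a ≠ b) : planeProj a b * skew a b = skew a b := by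
  simp [skew, planeProj, Matrix.add_mul, Matrix.mul_sub, h, h.symm]

theorem planeProj_mul_planeProj {a b : Fin d} (h : a ≠ b) :
    planeProj a b * planeProj a b = planeProj a b := by
  simp [planeProj, Matrix.mul_add, Matrix.add_mul, h, h.symm]

theorem transpose_skew (a b : Fin d) : (skew a b)ᵀ = -skew a b := by
  simp [skew]

theorem transpose_planeProj (a b : Fin d) : (planeProj a b)ᵀ = planeProj a b := by
  simp [planeProj]

theorem trace_skew {a b : Fin d} (h : a ≠ b) : (skew a b).trace = 0 := by
  simp [skew, Matrix.trace_single_eq_of_ne, h, h.symm]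

theorem trace_planeProj (a b : Fin d) : (planeProj a b).trace = 2 := by
  simp [planeProj]; norm_num

theorem trace_mul_skew (M : Matrix (Fin d) (Fin d) ℝ) (a b : Fin d) :
    (M * skew a b).trace = M b a - M a b := by
  simp [skew, Matrix.mul_sub, Matrix.trace_mul_single]

theorem trace_mul_planeProj (M : Matrix (Fin d) (Fin d) ℝ) (a b : Fin d) :
    (M * planeProj a b).trace = M a a + M b b := by
  simp [planeProj, Matrix.mul_add, Matrix.trace_mul_single]

/-- The rotation by the angle `t` in the coordinate plane `(a, b)`, as a matrix. -/
def rotMat (a b : Fin d) (t : ℝ) : Matrix (Fin d) (Fin d) ℝ :=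
  1 + Real.sin t • skew a b + (Real.cos t - 1) • planeProj a b

theorem rotMat_mul_rotMat {a b : Fin d} (h : a ≠ b) (s t : ℝ) :
    rotMat a b s * rotMat a b t = rotMat a b (s + t) := by
  simp only [rotMat, Matrix.mul_add, Matrix.add_mul, Matrix.one_mul, Matrix.mul_one,
    Matrix.smul_mul, Matrix.mul_smul, skew_mul_skew h, skew_mul_planeProj h, planeProj_mul_skew h,
    planeProj_mul_planeProj h, Real.sin_add, Real.cos_add]
  module

theorem transpose_rotMat (a b : Fin d) (t : ℝ) : (rotMat a b t)ᵀ = rotMat a b (-t) := by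
  simp [rotMat, transpose_skew, transpose_planeProj]

theorem rotMat_zero (a b : Fin d) : rotMat a b 0 = 1 := by simp [rotMat]

/-- The rotation by the angle `t` in the coordinate plane `(a, b)`. -/
def rot {a b : Fin d} (h : a ≠ b) (t : ℝ) : Matrix.orthogonalGroup (Fin d) ℝ :=
  ⟨rotMat a b t, (Matrix.mem_orthogonalGroup_iff (Fin d) ℝ).2 (by
    rw [transpose_rotMat, rotMat_mul_rotMat h, add_neg_cancel, rotMat_zero])⟩

theorem coe_rot {a b : Fin d} (h : a ≠ b) (t : ℝ) :
    (rot h t : Matrix (Fin d) (Fin d) ℝ) = rotMat a b t := rfl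

theorem rot_mul_rot {a b : Fin d} (h : a ≠ b) (s t : ℝ) : rot h s * rot h t = rot h (s + t) :=
  Subtype.ext (rotMat_mul_rotMat h s t)

theorem rot_inv {a b : Fin d} (h : a ≠ b) (t : ℝ) : (rot h t)⁻¹ = rot h (-t) :=
  Subtype.ext (transpose_rotMat a b t)

theorem frobSq_rot_sub_one {a b : Fin d} (h : a ≠ b) (t : ℝ) :
    frobSq ((rot h t : Matrix (Fin d) (Fin d) ℝ) - 1) = 4 * (1 - Real.cos t) := by
  rw [frobSq_coe_sub_one, coe_rot, rotMat, Matrix.trace_add, Matrix.trace_add, Matrix.trace_smul,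
    Matrix.trace_smul, trace_skew h, trace_planeProj]
  simp
  ring

/-- The skew component is a trace against `skew a b`, which commutes with the rotation; by cyclicity
the two half rotations merge into one rotation by `t` acting on `skew a b`. -/
theorem skew_comp_rot_mul_rot {a b : Fin d} (h : a ≠ b) (M : Matrix (Fin d) (Fin d) ℝ) (t : ℝ) :
    ((rot h (t / 2) : Matrix (Fin d) (Fin d) ℝ) * M * rot h (t / 2)) a b -
      ((rot h (t / 2) : Matrix (Fin d) (Fin d) ℝ) * M * rot h (t / 2)) b a =
      Real.cos t * (M a b - M b a) + Real.sin t * (M a a + M b b) := by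
  have hc : rotMat a b (t / 2) * skew a b * rotMat a b (t / 2) =
      Real.cos t • skew a b - Real.sin t • planeProj a b := by
    have h1 : skew a b * rotMat a b (t / 2) = rotMat a b (t / 2) * skew a b := by
      simp only [rotMat, Matrix.mul_add, Matrix.add_mul, Matrix.one_mul, Matrix.mul_one,
        Matrix.smul_mul, Matrix.mul_smul, skew_mul_planeProj h, planeProj_mul_skew h]
    rw [← h1, Matrix.mul_assoc, rotMat_mul_rotMat h, add_halves]
    simp only [rotMat, Matrix.mul_add, Matrix.mul_one, Matrix.mul_smul, skew_mul_skew h,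
      skew_mul_planeProj h]
    module
  have h2 := trace_mul_skew (rotMat a b (t / 2) * M * rotMat a b (t / 2)) a b
  rw [Matrix.mul_assoc, Matrix.mul_assoc, Matrix.trace_mul_comm, Matrix.mul_assoc, hc,
    Matrix.mul_sub, Matrix.mul_smul, Matrix.mul_smul, Matrix.trace_sub, Matrix.trace_smul,
    Matrix.trace_smul, trace_mul_skew, trace_mul_planeProj, smul_eq_mul, smul_eq_mul] at h2
  rw [coe_rot]
  linarith

end Rotation

/-! ### Compactness, the invariant prior, measurability -/

section Topology

variable {n d : ℕ}

instance : SecondCountableTopology (Matrix (Fin d) (Fin d) ℝ) :=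
  inferInstanceAs (SecondCountableTopology (Fin d → Fin d → ℝ))

instance : BorelSpace (Matrix (Fin d) (Fin d) ℝ) :=
  inferInstanceAs (BorelSpace (Fin d → Fin d → ℝ))

instance : SecondCountableTopology (Matrix.orthogonalGroup (Fin d) ℝ) :=
  TopologicalSpace.Subtype.secondCountableTopology
    (Matrix.orthogonalGroup (Fin d) ℝ : Set (Matrix (Fin d) (Fin d) ℝ))

instance : BorelSpace (Matrix.orthogonalGroup (Fin d) ℝ) :=
  inferInstanceAs (BorelSpace
    {U : Matrix (Fin d) (Fin d) ℝ // U ∈ Matrix.orthogonalGroup (Fin d) ℝ})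

instance : CompactSpace (Matrix.orthogonalGroup (Fin d) ℝ) := by
  refine isCompact_iff_compactSpace.1 ?_
  have hK : IsCompact (Set.univ.pi fun _ : Fin d => Set.univ.pi fun _ : Fin d =>
      Set.Icc (-1 : ℝ) 1) :=
    isCompact_univ_pi fun _ => isCompact_univ_pi fun _ => isCompact_Icc
  have hc : IsClosed (Matrix.orthogonalGroup (Fin d) ℝ : Set (Matrix (Fin d) (Fin d) ℝ)) :=
    isClosed_unitary (R := Matrix (Fin d) (Fin d) ℝ)
  exact hK.of_isClosed_subset hc fun U hU a _ b _ => abs_le.1 (abs_coe_apply_le ⟨U, hU⟩ a b)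

/-- Haar measure is constructed left-invariant; its image under inversion is right-invariant, as
needed for perturbations `Z * h`. -/
theorem exists_isMulRightInvariant (n d : ℕ) :
    ∃ π : Measure (Param n d), IsProbabilityMeasure π ∧ π.IsMulRightInvariant := by
  have : Nonempty (Param n d) := ⟨1⟩
  let μ : Measure (Param n d) := Measure.haarMeasure ⊤
  have hμ : IsProbabilityMeasure μ :=
    ⟨by simpa using Measure.haarMeasure_self (K₀ := (⊤ : TopologicalSpace.PositiveCompacts (Param n d)))⟩
  exact ⟨μ.inv, Measure.isProbabilityMeasure_map measurable_inv.aemeasurable, inferInstance⟩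

theorem continuous_relErr (i j : Fin n) :
    Continuous fun x : Param n d × Param n d => relErr i j x.1 x.2 := by
  unfold relErr; fun_prop

theorem measurable_relErr_apply (i j : Fin n) (a b : Fin d) :
    Measurable fun x : Param n d × Param n d =>
      (relErr i j x.1 x.2 : Matrix (Fin d) (Fin d) ℝ) a b :=
  ((Continuous.matrix_elem (continuous_induced_dom (f := Subtype.val)) a b).comp
    (continuous_relErr i j)).measurable

end Topology

/-! ### Passage to infinitesimal rotations -/

section Analysis

open Filter Topology

/-- Divide by `t` and let `t` decrease to `0`. The Young weight `c * t` shrinks with `t`, so that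
both terms on the right are of order `t`. -/
theorem le_of_forall_sin_cos_le {A B Q D c : ℝ} {H : ℝ → ℝ} (hc : 0 < c) (hH : HasDerivAt H D 0)
    (h : ∀ t, 0 < t → Real.cos t * A + Real.sin t * B - A ≤
      c * t / 2 * Q + (H (t ^ 2) - H 0) / (2 * (c * t))) :
    B ≤ c / 2 * Q + D / (2 * c) := by
  have hpos : 𝓝[>] (0 : ℝ) ≤ 𝓝[≠] 0 := nhdsWithin_mono _ fun x hx => ne_of_gt hx
  have hcos : Tendsto (fun t : ℝ => t⁻¹ * (Real.cos t - 1)) (𝓝[>] 0) (𝓝 0) := by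
    have := (hasDerivAt_iff_tendsto_slope_zero.1 (Real.hasDerivAt_cos 0)).mono_left hpos
    simpa using this
  have hsin : Tendsto (fun t : ℝ => t⁻¹ * Real.sin t) (𝓝[>] 0) (𝓝 1) := by
    have := (hasDerivAt_iff_tendsto_slope_zero.1 (Real.hasDerivAt_sin 0)).mono_left hpos
    simpa using this
  have hsq : Tendsto (fun t : ℝ => t ^ 2) (𝓝[>] 0) (𝓝[≠] 0) := by
    refine tendsto_nhdsWithin_of_tendsto_nhds_of_eventually_within _ ?_ ?_
    · have : Tendsto (fun t : ℝ => t ^ 2) (𝓝 0) (𝓝 (0 ^ 2)) := (continuous_pow 2).tendsto 0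
      exact (by simpa using this : Tendsto (fun t : ℝ => t ^ 2) (𝓝 0) (𝓝 0)).mono_left
        nhdsWithin_le_nhds
    · filter_upwards [self_mem_nhdsWithin] with t ht
      exact pow_ne_zero 2 (ne_of_gt ht)
  have hHt : Tendsto (fun t : ℝ => (t ^ 2)⁻¹ * (H (t ^ 2) - H 0)) (𝓝[>] 0) (𝓝 D) := by
    have := (hasDerivAt_iff_tendsto_slope_zero.1 hH).comp hsq
    simpa [Function.comp_def] using this
  have hl := (hcos.mul_const A).add (hsin.mul_const B)
  have hr := (tendsto_const_nhds (x := c / 2 * Q)).add (hHt.div_const (2 * c))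
  refine le_trans (by simp) (le_of_tendsto_of_tendsto hl hr ?_)
  filter_upwards [self_mem_nhdsWithin] with t ht
  have ht : 0 < t := ht
  have := mul_le_mul_of_nonneg_left (h t ht) (inv_pos.2 ht).le
  calc t⁻¹ * (Real.cos t - 1) * A + t⁻¹ * Real.sin t * B
      = t⁻¹ * (Real.cos t * A + Real.sin t * B - A) := by ring
    _ ≤ _ := this
    _ = _ := by field_simp

/-- Every factor equals `1` at `0`, so the derivatives add. With `u = t ^ 2` this is the Fisher
information of the rotation path. -/
theorem hasDerivAt_prod_mixture {ι : Type*} [Fintype ι] (p : ℝ) (w : ι → ℝ) :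
    HasDerivAt (fun u : ℝ => ∏ e, (p * Real.exp (w e * u) + (1 - p))) (p * ∑ e, w e) 0 := by
  classical
  have h (e : ι) : HasDerivAt (fun u : ℝ => p * Real.exp (w e * u) + (1 - p)) (p * w e) 0 := by
    have h1 : HasDerivAt (fun u : ℝ => w e * u) (w e) 0 := by
      simpa using (hasDerivAt_id (0 : ℝ)).const_mul (w e)
    have := (h1.exp.const_mul p).add_const (1 - p)
    simpa using this
  have := HasDerivAt.fun_finsetProd (u := Finset.univ) fun e _ => h e
  simpa [Finset.mul_sum] using this

end Analysis

/-! ### Chi-square inequality for randomized estimators -/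

section Divergence

variable {n d : ℕ}

instance {σ : ℝ} {p : unitInterval} : IsMarkovKernel (model n d σ p) :=
  ⟨fun _ => Measure.isProbabilityMeasure_map
    ((measurable_observe σ).comp measurable_prodMk_left).aemeasurable⟩

theorem integral_comp_model {σ : ℝ} {p : unitInterval}
    (κ : Kernel (Sample n d) (Param n d)) [IsMarkovKernel κ] (Z : Param n d) {φ : Param n d → ℝ}
    {B : ℝ} (hφ : Measurable φ) (hB : ∀ x, |φ x| ≤ B) :
    ∫ x, φ x ∂((κ ∘ₖ model n d σ p) Z) =
      ∫ ω, (∫ x, φ x ∂(κ (observe σ Z ω))) ∂(noiseLaw n d p) := by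
  have hobs : Measurable (observe σ Z) := (measurable_observe σ).comp measurable_prodMk_left
  have hm : Measurable fun y => ∫ x, φ x ∂(κ y) :=
    ((hφ.comp measurable_snd).stronglyMeasurable.integral_kernel_prod_right'
      (f := fun q : Sample n d × Param n d => φ q.2) (κ := κ)).measurable
  rw [Kernel.integral_comp (Integrable.of_bound hφ.aestronglyMeasurable B
    (Filter.Eventually.of_forall hB))]
  exact integral_map hobs.aemeasurable hm.aestronglyMeasurable

/-- The tilt inequality is applied to the conditional mean of `φ` given the data, with the
conditional mean of `φ ^ 2` as the quadratic term; randomization is harmless because Young's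
inequality survives averaging over `κ`. -/
theorem chiSq_bound {σ : ℝ} (hσ : σ ≠ 0) {p : unitInterval}
    (κ : Kernel (Sample n d) (Param n d)) [IsMarkovKernel κ] (Z Z' : Param n d)
    {φ : Param n d → ℝ} {B l : ℝ} (hφ : Measurable φ) (hB : ∀ x, |φ x| ≤ B) (hl : 0 < l) :
    ∫ x, φ x ∂((κ ∘ₖ model n d σ p) Z') - ∫ x, φ x ∂((κ ∘ₖ model n d σ p) Z) ≤
      l / 2 * ∫ x, φ x ^ 2 ∂((κ ∘ₖ model n d σ p) Z) +
        (∏ e : Pair n, (p * Real.exp (frobSq (σ⁻¹ • ((Z' e.1.1 : Matrix (Fin d) (Fin d) ℝ) *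
          (Z' e.1.2 : Matrix (Fin d) (Fin d) ℝ)ᵀ - (Z e.1.1 : Matrix (Fin d) (Fin d) ℝ) *
          (Z e.1.2 : Matrix (Fin d) (Fin d) ℝ)ᵀ))) + (1 - p)) - 1) / (2 * l) := by
  have hobs : Measurable (observe (n := n) (d := d) σ Z) :=
    (measurable_observe σ).comp measurable_prodMk_left
  have hmeas {ψ : Param n d → ℝ} (hψ : Measurable ψ) :
      Measurable fun ω => ∫ x, ψ x ∂(κ (observe σ Z ω)) :=
    ((hψ.comp measurable_snd).stronglyMeasurable.integral_kernel_prod_right'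
      (f := fun q : Sample n d × Param n d => ψ q.2) (κ := κ)).measurable.comp hobs
  have hbd {ψ : Param n d → ℝ} {K : ℝ} (hψ : ∀ x, |ψ x| ≤ K) (y : Sample n d) :
      |∫ x, ψ x ∂(κ y)| ≤ K := by
    have := norm_integral_le_of_norm_le_const (μ := κ y)
      (Filter.Eventually.of_forall fun x => (Real.norm_eq_abs (ψ x)).trans_le (hψ x))
    simpa using this
  have hB2 (x) : |φ x ^ 2| ≤ B ^ 2 := by
    rw [abs_pow]; exact pow_le_pow_left₀ (abs_nonneg _) (hB x) 2
  obtain ⟨f, hf⟩ := isTilt_noiseLaw p fun e : Pair n =>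
    σ⁻¹ • ((Z' e.1.1 : Matrix (Fin d) (Fin d) ℝ) *
      (Z' e.1.2 : Matrix (Fin d) (Fin d) ℝ)ᵀ - (Z e.1.1 : Matrix (Fin d) (Fin d) ℝ) *
      (Z e.1.2 : Matrix (Fin d) (Fin d) ℝ)ᵀ)
  have key := hf.integral_comp_sub_le (l := l) (B := B)
    (g := fun ω => ∫ x, φ x ∂(κ (observe σ Z ω)))
    (g₂ := fun ω => ∫ x, φ x ^ 2 ∂(κ (observe σ Z ω))) (hmeas hφ) (fun ω => hbd hB _)
    (Integrable.of_bound (hmeas (hφ.pow_const 2)).aestronglyMeasurable (B ^ 2)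
      (Filter.Eventually.of_forall fun ω => hbd hB2 _)) ?_
  · simp only [observe_shift hσ] at key
    rw [integral_comp_model κ Z' hφ hB, integral_comp_model κ Z hφ hB,
      integral_comp_model κ Z (hφ.pow_const 2) hB2]
    exact key
  · intro ω s
    have i1 : Integrable φ (κ (observe σ Z ω)) :=
      Integrable.of_bound hφ.aestronglyMeasurable B (Filter.Eventually.of_forall hB)
    have i2 : Integrable (fun x => φ x ^ 2) (κ (observe σ Z ω)) :=
      Integrable.of_bound (hφ.pow_const 2).aestronglyMeasurable (B ^ 2)
        (Filter.Eventually.of_forall hB2)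
    have hc : ∫ _, s ^ 2 / (2 * l) ∂(κ (observe σ Z ω)) = s ^ 2 / (2 * l) := by simp
    rw [← integral_const_mul, ← integral_const_mul, ← hc,
      ← integral_add (i2.const_mul _) (integrable_const _)]
    refine integral_mono (i1.const_mul _) ((i2.const_mul _).add (integrable_const _)) fun x => ?_
    have : 0 ≤ (s - l * φ x) ^ 2 / (2 * l) := by positivity
    have e : (s - l * φ x) ^ 2 / (2 * l) =
        l / 2 * φ x ^ 2 + s ^ 2 / (2 * l) - s * φ x := by field_simp; ring
    simp only
    linarith

end Divergence

/-! ### Information along a pair rotation -/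

section Weights

theorem two_mul_sum_pair {n : ℕ} (f : Fin n → Fin n → ℝ) (hs : ∀ k l, f k l = f l k)
    (h0 : ∀ k, f k k = 0) : 2 * ∑ e : Pair n, f e.1.1 e.1.2 = ∑ k, ∑ l, f k l := by
  have h1 : ∑ e : Pair n, f e.1.1 e.1.2 =
      ∑ q ∈ Finset.univ.filter (fun q : Fin n × Fin n => q.1 < q.2), f q.1 q.2 :=
    (Finset.sum_subtype _ (by simp) fun q : Fin n × Fin n => f q.1 q.2).symm
  have h2 : ∑ k, ∑ l, f k l = ∑ k, ∑ l, ((if k < l then f k l else 0) +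
      (if l < k then f k l else 0)) := by
    refine Finset.sum_congr rfl fun k _ => Finset.sum_congr rfl fun l _ => ?_
    rcases lt_trichotomy k l with h | rfl | h
    · simp [h, h.not_gt]
    · simp [h0]
    · simp [h, h.not_gt]
  rw [h2]
  simp only [Finset.sum_add_distrib]
  rw [Finset.sum_comm (f := fun k l => if l < k then f k l else 0), h1, Finset.sum_filter,
    Fintype.sum_prod_type, two_mul]
  simp only [fun k l => hs l k]

/-- The direction in which the pair `(i, j)` is rotated: half of the angle forwards at `i` and
half of it backwards at `j`. -/
def dir {n : ℕ} (i j k : Fin n) : ℝ := (if k = i then 1 / 2 else 0) - (if k = j then 1 / 2 else 0)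

/-- For weights summing to zero, the squared differences over unordered pairs sum to `n` times the
sum of squares, here `1 / 2`. -/
theorem sum_pair_dir {n : ℕ} {i j : Fin n} (hij : i ≠ j) :
    ∑ e : Pair n, (2 : ℝ) * (dir i j e.1.1 - dir i j e.1.2) ^ 2 = (n : ℝ) := by
  have h := two_mul_sum_pair (fun k l => 2 * (dir i j k - dir i j l) ^ 2)
    (fun k l => by ring) (fun k => by ring)
  have hs : ∑ k, dir i j k = 0 := by simp [dir]
  have hq : ∑ k, dir i j k ^ 2 = 1 / 2 := by
    have (k : Fin n) : dir i j k ^ 2 = (if k = i then 1 / 4 else 0) + (if k = j then 1 / 4 else 0) := by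
      unfold dir
      split_ifs with h1 h2 h2
      · exact absurd (h1.symm.trans h2) hij
      all_goals norm_num
    simp only [this, Finset.sum_add_distrib, Finset.sum_ite_eq', Finset.mem_univ, if_true]
    norm_num
  have : ∑ k, ∑ l, (2 : ℝ) * (dir i j k - dir i j l) ^ 2 = 2 * (n : ℝ) := by
    have (k l : Fin n) : 2 * (dir i j k - dir i j l) ^ 2 =
        2 * dir i j k ^ 2 + 2 * dir i j l ^ 2 - 4 * dir i j k * dir i j l := by ring
    simp only [this, Finset.sum_add_distrib, Finset.sum_sub_distrib, ← Finset.mul_sum, hs, hq]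
    simp [← Finset.mul_sum, hq]
    ring
  linarith

end Weights

/-! ### Bayesian Cramér-Rao bound for one pair -/

section Bayes

variable {n d : ℕ}

/-- The rotations of the coordinate plane `(a, b)` by the angle `dir i j k * t` at `k`. -/
def pairRot {a b : Fin d} (hab : a ≠ b) (i j : Fin n) (t : ℝ) : Param n d :=
  fun k => rot hab (dir i j k * t)

/-- Only the difference of the angles at `k` and `l` matters, since `Z k` and `Z l` act as
isometries; then `4 (1 - cos θ) ≤ 2 θ²`. -/
theorem frobSq_mul_pairRot_le {a b : Fin d} (hab : a ≠ b) (i j k l : Fin n) (t σ : ℝ)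
    (Z : Param n d) :
    frobSq (σ⁻¹ • (((Z * pairRot hab i j t) k : Matrix (Fin d) (Fin d) ℝ) *
      ((Z * pairRot hab i j t) l : Matrix (Fin d) (Fin d) ℝ)ᵀ -
        (Z k : Matrix (Fin d) (Fin d) ℝ) * (Z l : Matrix (Fin d) (Fin d) ℝ)ᵀ)) ≤
      2 * (dir i j k - dir i j l) ^ 2 / σ ^ 2 * t ^ 2 := by
  have h1 : ((Z * pairRot hab i j t) k : Matrix (Fin d) (Fin d) ℝ) *
      ((Z * pairRot hab i j t) l : Matrix (Fin d) (Fin d) ℝ)ᵀ =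
      (Z k : Matrix (Fin d) (Fin d) ℝ) *
        (rot hab ((dir i j k - dir i j l) * t) : Matrix (Fin d) (Fin d) ℝ) *
        ((Z l)⁻¹ : Matrix.orthogonalGroup (Fin d) ℝ) := by
    have : (Z * pairRot hab i j t) k * ((Z * pairRot hab i j t) l)⁻¹ =
        Z k * rot hab ((dir i j k - dir i j l) * t) * (Z l)⁻¹ := by
      have : rot hab ((dir i j k - dir i j l) * t) =
          rot hab (dir i j k * t) * (rot hab (dir i j l * t))⁻¹ := by
        rw [rot_inv, rot_mul_rot]; congr 1; ring
      rw [this]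
      simp only [Pi.mul_apply, pairRot]
      group
    exact congrArg Subtype.val this
  have h2 : (Z k : Matrix (Fin d) (Fin d) ℝ) *
        (rot hab ((dir i j k - dir i j l) * t) : Matrix (Fin d) (Fin d) ℝ) *
        ((Z l)⁻¹ : Matrix.orthogonalGroup (Fin d) ℝ) -
        (Z k : Matrix (Fin d) (Fin d) ℝ) * (Z l : Matrix (Fin d) (Fin d) ℝ)ᵀ =
      (Z k : Matrix (Fin d) (Fin d) ℝ) *
        ((rot hab ((dir i j k - dir i j l) * t) : Matrix (Fin d) (Fin d) ℝ) - 1) *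
        ((Z l)⁻¹ : Matrix.orthogonalGroup (Fin d) ℝ) := by
    rw [← coe_inv, Matrix.mul_sub, Matrix.sub_mul, Matrix.mul_one]
  rw [h1, h2, frobSq_smul, frobSq_mul_coe, frobSq_coe_mul, frobSq_rot_sub_one]
  have h3 := Real.one_sub_sq_div_two_le_cos (x := (dir i j k - dir i j l) * t)
  have h4 : 2 * (dir i j k - dir i j l) ^ 2 / σ ^ 2 * t ^ 2 =
      σ⁻¹ ^ 2 * (2 * ((dir i j k - dir i j l) * t) ^ 2) := by ring
  rw [h4]
  exact mul_le_mul_of_nonneg_left (by linarith) (sq_nonneg _)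

theorem dir_left {i j : Fin n} (hij : i ≠ j) : dir i j i = 1 / 2 := by simp [dir, hij]

theorem dir_right {i j : Fin n} (hij : i ≠ j) : dir i j j = -(1 / 2) := by simp [dir, hij.symm]

/-- The component of the relative error along the rotations of the coordinate plane `(a, b)`. -/
def skewErr (i j : Fin n) (a b : Fin d) (x : Param n d × Param n d) : ℝ :=
  (relErr i j x.1 x.2 : Matrix (Fin d) (Fin d) ℝ) a b -
    (relErr i j x.1 x.2 : Matrix (Fin d) (Fin d) ℝ) b a

/-- The trace of the relative error on the coordinate plane `(a, b)`. -/
def diagErr (i j : Fin n) (a b : Fin d) (x : Param n d × Param n d) : ℝ :=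
  (relErr i j x.1 x.2 : Matrix (Fin d) (Fin d) ℝ) a a +
    (relErr i j x.1 x.2 : Matrix (Fin d) (Fin d) ℝ) b b

theorem measurable_skewErr (i j : Fin n) (a b : Fin d) :
    Measurable (skewErr (n := n) (d := d) i j a b) :=
  (measurable_relErr_apply i j a b).sub (measurable_relErr_apply i j b a)

theorem abs_skewErr_le (i j : Fin n) (a b : Fin d) (x : Param n d × Param n d) :
    |skewErr i j a b x| ≤ 2 := by
  have := abs_sub ((relErr i j x.1 x.2 : Matrix (Fin d) (Fin d) ℝ) a b)
    ((relErr i j x.1 x.2 : Matrix (Fin d) (Fin d) ℝ) b a)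
  unfold skewErr
  linarith [abs_coe_apply_le (relErr i j x.1 x.2) a b, abs_coe_apply_le (relErr i j x.1 x.2) b a]

variable {i j : Fin n} {π : Measure (Param n d)} [IsProbabilityMeasure π]

theorem integrable_skewErr (ρ : Measure (Param n d × Param n d)) [IsFiniteMeasure ρ]
    (i j : Fin n) (a b : Fin d) : Integrable (skewErr i j a b) ρ :=
  Integrable.of_bound (measurable_skewErr i j a b).aestronglyMeasurable 2
    (Filter.Eventually.of_forall fun _ => abs_skewErr_le i j a b _)

theorem integrable_skewErr_sq (ρ : Measure (Param n d × Param n d)) [IsFiniteMeasure ρ]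
    (i j : Fin n) (a b : Fin d) : Integrable (fun x => skewErr i j a b x ^ 2) ρ := by
  refine Integrable.of_bound ((measurable_skewErr i j a b).pow_const 2).aestronglyMeasurable
    (2 ^ 2) (Filter.Eventually.of_forall fun x => ?_)
  rw [norm_pow, Real.norm_eq_abs]
  exact pow_le_pow_left₀ (abs_nonneg _) (abs_skewErr_le i j a b _) 2

theorem integrable_relErr_apply (ρ : Measure (Param n d × Param n d)) [IsFiniteMeasure ρ]
    (i j : Fin n) (a b : Fin d) :
    Integrable (fun x => (relErr i j x.1 x.2 : Matrix (Fin d) (Fin d) ℝ) a b) ρ :=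
  Integrable.of_bound (measurable_relErr_apply i j a b).aestronglyMeasurable 1
    (Filter.Eventually.of_forall fun _ => abs_coe_apply_le _ a b)

theorem integrable_diagErr (ρ : Measure (Param n d × Param n d)) [IsFiniteMeasure ρ]
    (i j : Fin n) (a b : Fin d) : Integrable (diagErr i j a b) ρ :=
  (integrable_relErr_apply ρ i j a a).add (integrable_relErr_apply ρ i j b b)

/-- The opposite signs of `dir` at `i` and `j` turn into equal half rotations on the two sides of
the relative error. -/
theorem skewErr_mul_pairRot_inv (hij : i ≠ j) {a b : Fin d} (hab : a ≠ b) (t : ℝ)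
    (Z Zhat : Param n d) :
    skewErr i j a b (Z * (pairRot hab i j t)⁻¹, Zhat) =
      Real.cos t * skewErr i j a b (Z, Zhat) + Real.sin t * diagErr i j a b (Z, Zhat) := by
  have e1 : pairRot hab i j t i = rot hab (t / 2) := by
    simp only [pairRot, dir_left hij]; congr 1; ring
  have e2 : (pairRot hab i j t j)⁻¹ = rot hab (t / 2) := by
    simp only [pairRot, dir_right hij, rot_inv]; congr 1; ring
  simp only [skewErr, diagErr]
  rw [relErr_mul_inv, e1, e2]
  exact skew_comp_rot_mul_rot hab _ t

/-- The Bayesian Cramér-Rao inequality for the rotation of a coordinate plane. -/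
theorem integral_diagErr_le [π.IsMulRightInvariant] {σ : ℝ} (hσ : σ ≠ 0) {p : unitInterval}
    (κ : Kernel (Sample n d) (Param n d)) [IsMarkovKernel κ] (hij : i ≠ j) {a b : Fin d}
    (hab : a ≠ b) {c : ℝ} (hc : 0 < c) :
    ∫ x, diagErr i j a b x ∂(π ⊗ₘ (κ ∘ₖ model n d σ p)) ≤
      c / 2 * ∫ x, skewErr i j a b x ^ 2 ∂(π ⊗ₘ (κ ∘ₖ model n d σ p)) +
        (n * p / σ ^ 2) / (2 * c) := by
  set ρ := π ⊗ₘ (κ ∘ₖ model n d σ p) with hρ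
  set w : Pair n → ℝ := fun e => 2 * (dir i j e.1.1 - dir i j e.1.2) ^ 2 / σ ^ 2 with hw
  set H : ℝ → ℝ := fun u => ∏ e : Pair n, (p * Real.exp (w e * u) + (1 - p)) with hH
  have hwn : p * ∑ e, w e = n * p / σ ^ 2 := by
    simp only [hw]
    rw [← Finset.sum_div, sum_pair_dir hij]; ring
  have hD : HasDerivAt H (n * p / σ ^ 2) 0 := hwn ▸ hasDerivAt_prod_mixture (p : ℝ) w
  have hH0 : H 0 = 1 := by simp [hH]
  have hp0 : (0 : ℝ) ≤ p := p.2.1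
  have hp1 : (0 : ℝ) ≤ 1 - p := sub_nonneg.2 p.2.2
  have iS := integrable_skewErr ρ i j a b
  have iS2 := integrable_skewErr_sq ρ i j a b
  have iD := integrable_diagErr ρ i j a b
  refine le_of_forall_sin_cos_le (A := ∫ x, skewErr i j a b x ∂ρ) hc hD fun t ht => ?_
  set h : Param n d := pairRot hab i j t with hh
  have hZ (Z : Param n d) :
      ∫ x, skewErr i j a b (Z, x) ∂((κ ∘ₖ model n d σ p) (Z * h)) -
      ∫ x, skewErr i j a b (Z, x) ∂((κ ∘ₖ model n d σ p) Z) ≤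
      c * t / 2 * ∫ x, skewErr i j a b (Z, x) ^ 2 ∂((κ ∘ₖ model n d σ p) Z) +
      (H (t ^ 2) - H 0) / (2 * (c * t)) := by
    refine (chiSq_bound hσ κ Z (Z * h) (B := 2) (l := c * t)
      ((measurable_skewErr i j a b).comp measurable_prodMk_left)
      (fun x => abs_skewErr_le i j a b (Z, x)) (by positivity)).trans ?_
    rw [hH0]
    refine add_le_add le_rfl (div_le_div_of_nonneg_right (sub_le_sub_right
      (Finset.prod_le_prod (fun e _ => by positivity) fun e _ => ?_) 1) (by positivity))
    exact add_le_add (mul_le_mul_of_nonneg_left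
      (Real.exp_le_exp.2 (frobSq_mul_pairRot_le hab i j e.1.1 e.1.2 t σ Z)) hp0) le_rfl
  have hint {ψ : Param n d × Param n d → ℝ} (hψ : Integrable ψ ρ) :
      Integrable (fun Z => ∫ x, ψ (Z, x) ∂((κ ∘ₖ model n d σ p) Z)) π :=
    (show Integrable ψ ((Kernel.const Unit π ⊗ₖ Kernel.prodMkLeft Unit (κ ∘ₖ model n d σ p)) ())
      from hψ).integral_compProd
  have iT : Integrable (fun x => Real.cos t * skewErr i j a b x +
      Real.sin t * diagErr i j a b x) ρ := (iS.const_mul _).add (iD.const_mul _)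
  have hlhs : ∫ Z, ∫ x, skewErr i j a b (Z, x) ∂((κ ∘ₖ model n d σ p) (Z * h)) ∂π =
      Real.cos t * ∫ x, skewErr i j a b x ∂ρ + Real.sin t * ∫ x, diagErr i j a b x ∂ρ := by
    -- Invariance of the prior moves the perturbation from the law of the data to the test function,
    -- where its effect is an explicit rotation.
    have e := integral_mul_right_eq_self (μ := π) (fun Z => ∫ x,
      skewErr i j a b (Z * h⁻¹, x) ∂((κ ∘ₖ model n d σ p) Z)) h
    simp only [mul_inv_cancel_right] at e
    rw [e, ← integral_const_mul, ← integral_const_mul,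
      ← integral_add (iS.const_mul _) (iD.const_mul _), hρ, Measure.integral_compProd iT]
    simp only [hh, skewErr_mul_pairRot_inv hij]
  have iL : Integrable (fun Z => ∫ x, skewErr i j a b (Z, x)
      ∂((κ ∘ₖ model n d σ p) (Z * h))) π := by
    have := (hint iT).comp_mul_right h
    simp only [← skewErr_mul_pairRot_inv hij hab, ← hh, mul_inv_cancel_right] at this
    exact this
  have hmono := integral_mono (iL.sub (hint iS))
    (((hint iS2).const_mul (c * t / 2)).add (integrable_const ((H (t ^ 2) - H 0) / (2 * (c * t)))))
    hZ
  rw [integral_sub' iL (hint iS), hlhs, ← Measure.integral_compProd iS] at hmono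
  refine hmono.trans (le_of_eq ?_)
  simp only [Pi.add_apply]
  rw [integral_add ((hint iS2).const_mul (c * t / 2)) (integrable_const _), integral_const_mul,
    ← Measure.integral_compProd iS2, ← hρ]
  simp

/-- The Bayes risk for the relative orientation of a pair. -/
theorem pair_bayes_bound [π.IsMulRightInvariant] {σ : ℝ} (hσ : 0 < σ) {p : unitInterval}
    (hnp : 0 < (n : ℝ) * p / σ ^ 2)
    (κ : Kernel (Sample n d) (Param n d)) [IsMarkovKernel κ] (hij : i ≠ j) :
    (d : ℝ) * (d - 1) ≤ (n * p / σ ^ 2 + (d - 1)) *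
      ∫ x, frobSq ((relErr i j x.1 x.2 : Matrix (Fin d) (Fin d) ℝ) - 1)
        ∂(π ⊗ₘ (κ ∘ₖ model n d σ p)) := by
  set ρ := π ⊗ₘ (κ ∘ₖ model n d σ p) with hρ
  set I : ℝ := n * p / σ ^ 2 with hI
  set R : ℝ := ∫ x, frobSq ((relErr i j x.1 x.2 : Matrix (Fin d) (Fin d) ℝ) - 1) ∂ρ with hR
  have iM (a b : Fin d) := integrable_relErr_apply ρ i j a b
  have itr : Integrable (fun x => (relErr i j x.1 x.2 : Matrix (Fin d) (Fin d) ℝ).trace) ρ :=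
    integrable_finsetSum _ fun a _ => iM a a
  have hfrob : (fun x : Param n d × Param n d =>
      frobSq ((relErr i j x.1 x.2 : Matrix (Fin d) (Fin d) ℝ) - 1)) =
      fun x => 2 * d - 2 * (relErr i j x.1 x.2 : Matrix (Fin d) (Fin d) ℝ).trace := by
    funext x; exact frobSq_coe_sub_one _
  have ifrob : Integrable (fun x : Param n d × Param n d =>
      frobSq ((relErr i j x.1 x.2 : Matrix (Fin d) (Fin d) ℝ) - 1)) ρ := by
    rw [hfrob]; exact (integrable_const _).sub (itr.const_mul 2)
  have htr : R = 2 * d - 2 * ∑ a, ∫ x, (relErr i j x.1 x.2 : Matrix (Fin d) (Fin d) ℝ) a a ∂ρ := by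
    rw [hR, hfrob, integral_sub (integrable_const _) (itr.const_mul 2),
      integral_const_mul 2 fun x : Param n d × Param n d =>
        (relErr i j x.1 x.2 : Matrix (Fin d) (Fin d) ℝ).trace]
    simp only [Matrix.trace, Matrix.diag_apply]
    rw [integral_finsetSum _ fun a _ => iM a a]
    simp
  have hskew : ∑ a, ∑ b, ∫ x, skewErr i j a b x ^ 2 ∂ρ ≤ 4 * R := by
    rw [hR, ← integral_const_mul]
    simp only [← integral_finsetSum Finset.univ fun b _ => integrable_skewErr_sq ρ i j _ b]
    rw [← integral_finsetSum _ fun a _ => integrable_finsetSum _ fun b _ =>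
      integrable_skewErr_sq ρ i j a b]
    exact integral_mono (integrable_finsetSum _ fun a _ => integrable_finsetSum _ fun b _ =>
      integrable_skewErr_sq ρ i j a b) (ifrob.const_mul 4) fun x => sum_sq_skew_le _
  have hpair (a b : Fin d) : (if a = b then 0 else
      (∫ x, (relErr i j x.1 x.2 : Matrix (Fin d) (Fin d) ℝ) a a ∂ρ +
        ∫ x, (relErr i j x.1 x.2 : Matrix (Fin d) (Fin d) ℝ) b b ∂ρ) - 1) ≤
      I / 4 * ∫ x, skewErr i j a b x ^ 2 ∂ρ := by
    split_ifs with hab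
    · exact mul_nonneg (by positivity) (integral_nonneg fun x => sq_nonneg _)
    -- This `c` balances the two terms when the mean square of the skew error is `4 / I`, its value
    -- in the efficient case; each term is then `1`, matching a diagonal sum near `2`.
    · have := integral_diagErr_le (π := π) hσ.ne' (p := p) κ hij hab (c := I / 2) (by positivity)
      rw [← hρ, ← hI] at this
      have e : I / (2 * (I / 2)) = 1 := by field_simp
      rw [e] at this
      have e2 : ∫ x, diagErr i j a b x ∂ρ =
        ∫ x, (relErr i j x.1 x.2 : Matrix (Fin d) (Fin d) ℝ) a a ∂ρ +
        ∫ x, (relErr i j x.1 x.2 : Matrix (Fin d) (Fin d) ℝ) b b ∂ρ :=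
        integral_add (iM a a) (iM b b)
      linarith
  set m : Fin d → ℝ := fun a => ∫ x, (relErr i j x.1 x.2 : Matrix (Fin d) (Fin d) ℝ) a a ∂ρ with hm
  have hsum : ∑ a, ∑ b, (if a = b then 0 else m a + m b - 1) =
      2 * (d - 1) * ∑ a, m a - d * (d - 1) := by
    have (a b : Fin d) : (if a = b then 0 else m a + m b - 1) =
        (m a + m b - 1) - (if a = b then 2 * m a - 1 else 0) := by
      split_ifs with h
      · subst h; ring
      · ring
    simp only [this, Finset.sum_sub_distrib, Finset.sum_add_distrib, Finset.sum_ite_eq,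
      Finset.mem_univ, if_true, ← Finset.mul_sum]
    simp [← Finset.mul_sum]
    ring
  have hle : 2 * (d - 1) * ∑ a, m a - d * (d - 1) ≤ I / 4 * (4 * R) := by
    rw [← hsum]
    refine (Finset.sum_le_sum fun a _ => Finset.sum_le_sum fun b _ => hpair a b).trans ?_
    simp only [← Finset.mul_sum]
    exact mul_le_mul_of_nonneg_left hskew (by positivity)
  have hmR : ∑ a, m a = d - R / 2 := by linarith
  rw [hmR] at hle
  linarith

end Bayes

/-! ### From pairs to the minimax risk -/

theorem ofReal_le_risk {n d : ℕ} {σ : ℝ} {p : unitInterval} (hσ : 0 < σ)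
    (hnp : 0 < (n : ℝ) * p / σ ^ 2) (hd : 1 ≤ d) :
    ENNReal.ofReal (1 / (2 * (n : ℝ) ^ 2) *
      (n * (n - 1) * (d * (d - 1) / (n * p / σ ^ 2 + (d - 1))))) ≤ risk n d σ p := by
  obtain ⟨π, _, _⟩ := exists_isMulRightInvariant n d
  refine le_iInf₂ fun κ _ => ?_
  refine le_trans ?_ (avgRisk_le_iSup_risk _ _ _ π)
  set ρ := π ⊗ₘ (κ ∘ₖ model n d σ p) with hρ
  set r : Fin n → Fin n → Param n d × Param n d → ℝ := fun i j x =>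
    frobSq ((relErr i j x.1 x.2 : Matrix (Fin d) (Fin d) ℝ) - 1) with hr
  have hrm (i j) : Measurable (r i j) := by
    simp only [hr, frobSq]
    exact Finset.measurable_sum _ fun a _ => Finset.measurable_sum _ fun b _ =>
      ((measurable_relErr_apply i j a b).sub measurable_const).pow_const 2
  have hri (i j) : Integrable (r i j) ρ := by
    have : r i j = fun x => 2 * d - 2 * ∑ a, (relErr i j x.1 x.2 : Matrix (Fin d) (Fin d) ℝ) a a := by
      funext x; exact frobSq_coe_sub_one _
    rw [this]
    exact (integrable_const _).sub
      ((integrable_finsetSum _ fun a _ => integrable_relErr_apply ρ i j a a).const_mul 2)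
  set g : Param n d × Param n d → ℝ := fun x => 1 / (2 * (n : ℝ) ^ 2) * ∑ i, ∑ j, r i j x with hg
  have hgm : Measurable g := measurable_const.mul <|
    Finset.measurable_sum _ fun i _ => Finset.measurable_sum _ fun j _ => hrm i j
  have hgi : Integrable g ρ := Integrable.const_mul (integrable_finsetSum _ fun i _ =>
    integrable_finsetSum _ fun j _ => hri i j) _
  have hg0 (x) : 0 ≤ g x := mul_nonneg (by positivity)
    (Finset.sum_nonneg fun i _ => Finset.sum_nonneg fun j _ => frobSq_nonneg _)
  have hd' : (0 : ℝ) ≤ d - 1 := by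
    have : (1 : ℝ) ≤ d := by exact_mod_cast hd
    linarith
  calc _ ≤ ENNReal.ofReal (∫ x, g x ∂ρ) := by
        refine ENNReal.ofReal_le_ofReal ?_
        simp only [hg]
        rw [integral_const_mul, integral_finsetSum _ fun i _ => integrable_finsetSum _ fun j _ =>
          hri i j]
        refine mul_le_mul_of_nonneg_left ?_ (by positivity)
        set K : ℝ := d * (d - 1) / (n * p / σ ^ 2 + (d - 1)) with hK
        -- Diagonal pairs carry no error; this is the source of `n * (n - 1)` in place of `n ^ 2`.
        have hK' (i j : Fin n) : (if i = j then 0 else K) ≤ ∫ x, r i j x ∂ρ := by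
          split_ifs with hij
          · exact integral_nonneg fun x => frobSq_nonneg _
          · rw [hK, div_le_iff₀' (by positivity)]
            exact pair_bayes_bound hσ hnp κ hij
        calc (n : ℝ) * (n - 1) * K = ∑ i : Fin n, ∑ j : Fin n, (if i = j then 0 else K) := by
              have (i j : Fin n) : (if i = j then 0 else K) = K - (if i = j then K else 0) := by
                split_ifs <;> simp
              simp [this]
              ring
          _ ≤ _ := Finset.sum_le_sum fun i _ => by
              rw [integral_finsetSum _ fun j _ => hri i j]
              exact Finset.sum_le_sum fun j _ => hK' i j
    _ = ∫⁻ Z, ∫⁻ x, ENNReal.ofReal (g (Z, x)) ∂((κ ∘ₖ model n d σ p) Z) ∂π := by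
        rw [ofReal_integral_eq_lintegral_ofReal hgi (Filter.Eventually.of_forall hg0), hρ,
          Measure.lintegral_compProd hgm.ennreal_ofReal]
    _ ≤ _ := lintegral_mono fun Z => lintegral_mono fun x =>
        ENNReal.ofReal_le_ofReal (sum_relErr_le_loss Z x)

end OrthSync
end

theorem mainTheorem3 :
    ∃ c : ℝ, 0 < c ∧ ∀ C₁ : ℝ, ∃ C : ℝ, 0 < C ∧
      ∀ (n d : ℕ) (σ : ℝ) (p : unitInterval),
        0 < σ → c ≤ (n : ℝ) * p / σ ^ 2 → 2 ≤ d → (d : ℝ) ≤ C₁ →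
        ENNReal.ofReal
            ((1 - C * (1 / (n : ℝ) + σ ^ 2 / ((n : ℝ) * p))) *
              (σ ^ 2 * d * ((d : ℝ) - 1) / (2 * n * p)))
          ≤ OrthSync.risk n d σ p := by
  -- In `max 1 C₁`, the `1` covers the loss `1 / n` from diagonal pairs and `C₁` covers the factor
  -- `d - 1` in the curvature correction `(d - 1) * s`.
  refine ⟨1, one_pos, fun C₁ => ⟨max 1 C₁, by positivity, fun n d σ p hσ hc hd hdC => ?_⟩⟩
  have hI : 0 < (n : ℝ) * p / σ ^ 2 := one_pos.trans_le hc
  have hnp : 0 < (n : ℝ) * p := by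
    by_contra h
    exact absurd hI (not_lt.2 (div_nonpos_of_nonpos_of_nonneg (not_lt.1 h) (sq_nonneg _)))
  have hn : (0 : ℝ) < n := by
    refine (Nat.cast_nonneg n).lt_of_ne fun h => ?_
    rw [← h, zero_mul] at hnp
    exact lt_irrefl _ hnp
  have hn1 : (1 : ℝ) ≤ n := by exact_mod_cast Nat.cast_pos.1 hn
  have hd2 : (2 : ℝ) ≤ d := by exact_mod_cast hd
  refine le_trans (ENNReal.ofReal_le_ofReal ?_) (OrthSync.ofReal_le_risk hσ hI (by omega))
  set s : ℝ := σ ^ 2 / (n * p) with hs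
  have hs0 : 0 < s := by positivity
  have hIs : (n : ℝ) * p / σ ^ 2 = s⁻¹ := by rw [hs, inv_div]
  have hT : σ ^ 2 * d * ((d : ℝ) - 1) / (2 * n * p) = s * (d * (d - 1)) / 2 := by
    rw [hs]; field_simp
  have hr : 1 / (2 * (n : ℝ) ^ 2) * (n * (n - 1) * (d * (d - 1) / (s⁻¹ + (d - 1)))) =
      (1 - 1 / n) * (1 / (1 + (d - 1) * s)) * (s * (d * (d - 1)) / 2) := by
    have : 0 < 1 + ((d : ℝ) - 1) * s := by nlinarith
    have e : s⁻¹ + ((d : ℝ) - 1) = (1 + (d - 1) * s) / s := by field_simp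
    rw [e]
    field_simp
  rw [hIs, hT, hr]
  refine mul_le_mul_of_nonneg_right ?_ (by
    have : (0 : ℝ) ≤ d - 1 := by linarith
    positivity)
  set u : ℝ := (d - 1) * s with hu
  have hu0 : 0 ≤ u := mul_nonneg (by linarith) hs0.le
  have hu1 : 1 - u ≤ 1 / (1 + u) := by
    rw [le_div_iff₀ (by linarith)]; nlinarith
  have hn0 : 0 ≤ 1 - 1 / (n : ℝ) := by
    rw [sub_nonneg, div_le_one hn]; exact hn1
  have hn' : 0 < 1 / (n : ℝ) := by positivity
  have h1 : 1 / (n : ℝ) ≤ max 1 C₁ * (1 / n) := le_mul_of_one_le_left hn'.le (le_max_left _ _)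
  have h2 : u ≤ max 1 C₁ * s :=
    mul_le_mul_of_nonneg_right (by linarith [le_max_right 1 C₁]) hs0.le
  calc 1 - max 1 C₁ * (1 / (n : ℝ) + s) ≤ 1 - 1 / n - u := by linarith
    _ ≤ (1 - 1 / n) * (1 - u) := by nlinarith [mul_nonneg hn'.le hu0]
    _ ≤ _ := mul_le_mul_of_nonneg_left hu1 hn0
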